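/- Let $X$ be a compact topological space that is not contractible, and let $x\in X$. The alternating cone $AC(X,x)$ is defined as follows. Let $(X_n,x_n)$, $n=1,2,3,\dots$, be disjoint copies of $(X,x)$; connect $x_n$ and $x_{n+1}$ by an arc for each $n$, and add one new point, whose open neighborhoods are the sets that contain it, contain $X_n$ and the arc from $x_n$ to $x_{n+1}$ for all but finitely many $n$, and are open away from it. Call the resulting space $Y$. Then $AC(X,x)$ is the quotient space of $Y\times[0,1]$ in which $X_n\times\{0\}$ is collapsed to a point for every odd $n$ and $X_n\times\{1\}$ is collapsed to a point for every even $n$. Then $AC(X,x)$ is a compact space that is not contractible; moreover, if $X$ is Hausdorff, then so is $AC(X,x)$. -/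

import Mathlib

open scoped unitInterval

namespace AlternatingCone

variable {X : Type*} [TopologicalSpace X]

/-- The disjoint union of countably many copies of `X` and countably many arcs, both indexed by
`ℕ` starting at `0`: index `n` stands for the `(n + 1)`-st copy, respectively for the arc that
will join the `(n + 1)`-st copy to the next one. -/
abbrev Pieces (X : Type*) : Type _ := (ℕ × X) ⊕ (ℕ × I)

/-- The `n`-th arc starts at the base point of the `n`-th copy of `X` and ends at the base point
of the next copy. -/
inductive Glue (x : X) : Pieces X → Pieces X → Prop
  | start (n : ℕ) : Glue x (.inl (n, x)) (.inr (n, 0))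
  | finish (n : ℕ) : Glue x (.inl (n + 1, x)) (.inr (n, 1))

/-- The copies of `X` connected by arcs at their base points, with the quotient topology. -/
abbrev Chain (x : X) : Type _ := Quot (Glue x)

/-- The chain of copies of `X` and arcs together with one new point. -/
inductive Line (x : X) : Type _
  | infty : Line x
  | ofChain (c : Chain x) : Line x

namespace Line

/-- The point `a` of the `n`-th copy of `X`. -/
def copy (x : X) (n : ℕ) (a : X) : Line x := .ofChain (Quot.mk _ (.inl (n, a)))

/-- The point with parameter `s` of the `n`-th arc. -/
def arc (x : X) (n : ℕ) (s : I) : Line x := .ofChain (Quot.mk _ (.inr (n, s)))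

/-- A set is open if its trace on the chain is open and, in case it contains the new point, it
contains all but finitely many of the copies of `X` and of the arcs. -/
instance (x : X) : TopologicalSpace (Line x) where
  IsOpen U := IsOpen (Line.ofChain ⁻¹' U) ∧
    (Line.infty ∈ U → ∃ m : ℕ, ∀ n ≥ m, (∀ a : X, copy x n a ∈ U) ∧ ∀ s : I, arc x n s ∈ U)
  isOpen_univ := ⟨isOpen_univ, fun _ => ⟨0, fun _ _ => ⟨fun _ => trivial, fun _ => trivial⟩⟩⟩
  isOpen_inter U V hU hV := by
    refine ⟨hU.1.inter hV.1, fun h => ?_⟩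
    obtain ⟨m, hm⟩ := hU.2 h.1
    obtain ⟨k, hk⟩ := hV.2 h.2
    refine ⟨max m k, fun n hn => ?_⟩
    have h₁ := hm n (le_trans (le_max_left _ _) hn)
    have h₂ := hk n (le_trans (le_max_right _ _) hn)
    exact ⟨fun a => ⟨h₁.1 a, h₂.1 a⟩, fun s => ⟨h₁.2 s, h₂.2 s⟩⟩
  isOpen_sUnion S hS := by
    refine ⟨?_, ?_⟩
    · rw [Set.preimage_sUnion]
      exact isOpen_biUnion fun U hU => (hS U hU).1
    · rintro ⟨U, hU, h⟩
      obtain ⟨m, hm⟩ := (hS U hU).2 h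
      exact ⟨m, fun n hn => ⟨fun a => ⟨U, hU, (hm n hn).1 a⟩, fun s => ⟨U, hU, (hm n hn).2 s⟩⟩⟩

end Line

/-- In the `(n + 1)`-st copy of `X × I`, the bottom is collapsed to a point if `n + 1` is odd and
the top is collapsed to a point if `n + 1` is even. -/
inductive Collapse (x : X) : Line x × I → Line x × I → Prop
  | bottom (n : ℕ) (hn : Odd (n + 1)) (a : X) : Collapse x (Line.copy x n a, 0) (Line.copy x n x, 0)
  | top (n : ℕ) (hn : Even (n + 1)) (a : X) : Collapse x (Line.copy x n a, 1) (Line.copy x n x, 1)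

/-- The alternating cone `AC(X, x)`, with the quotient topology. -/
abbrev AC (X : Type*) [TopologicalSpace X] (x : X) : Type _ := Quot (Collapse x)

end AlternatingCone

/-! Suppose `H` contracts the cone, and let it move the point of `Line x` at height `h` until time
`t`; this gives maps `G (·, (h, t))` from the line to the cone. Call `(h, t)` essential for `e = 0`
or `e = 1` if the new point is not sent to its own copy at height `e`, and arbitrarily late copies
of `X` collapsed at height `e` give self-maps of `X`, by applying `G` and projecting back, that are
not null-homotopic. Unless the new point goes to height `e` over itself, this property is locally
constant in `(h, t)`. So the set `M` of parameters essential for both ends has its frontier in `C 0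
∪ C 1`, where `C e` consists of the parameters at which the new point does go there. At time 0 and
`0 < h < 1` the self-maps are the identity of `X`, so these parameters lie in `M`. For `h = 0` or `h
= 1` the copies collapsed there give constant maps, and so do all copies at time 1, so `M` misses
the other three sides. A frontier separating the bottom side from the others would have to connect
the two bottom corners, but they lie in the disjoint closed sets `C 0` and `C 1`. This is
`not_separates_bottom_of_frontier_subset_union`, proved by lifting a circle-valued map through
`Circle.exp`. -/

open Topology Set in
/-- An open set `M` of the plane whose frontier is covered by two disjoint closed sets cannot
separate the bottom side of the unit square from the other three sides, if the two bottom corners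
lie in different ones of the two closed sets. -/
theorem not_separates_bottom_of_frontier_subset_union {C₀ C₁ M : Set (ℝ × ℝ)}
    (h₀ : IsClosed C₀) (h₁ : IsClosed C₁) (hd : Disjoint C₀ C₁) (hM : frontier M ⊆ C₀ ∪ C₁)
    (hc₀ : ((0 : ℝ), (0 : ℝ)) ∈ C₀) (hc₁ : ((1 : ℝ), (0 : ℝ)) ∈ C₁)
    (hbot : ∀ h ∈ Icc (0 : ℝ) 1, (h, (0 : ℝ)) ∈ M ∪ (C₀ ∪ C₁))
    (hleft : ∀ t ∈ Icc (0 : ℝ) 1, ((0 : ℝ), t) ∉ M)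
    (hright : ∀ t ∈ Icc (0 : ℝ) 1, ((1 : ℝ), t) ∉ M)
    (htop : ∀ h ∈ Icc (0 : ℝ) 1, (h, (1 : ℝ)) ∉ M) : False := by
  classical
  obtain ⟨v, hv₀, hv₁, -⟩ := exists_continuous_zero_one_of_isClosed h₀ h₁ hd
  -- The two formulas agree where `v` is 0 or 1, both giving `1` or both `-1`, so they may be glued
  -- along the frontier of `M`.
  have key : ∀ p ∈ C₀ ∪ C₁, Circle.exp (Real.pi * v p) = Circle.exp (-(Real.pi * v p)) := by
    rintro p (hp | hp)
    · simp [hv₀ hp]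
    · rw [Circle.exp_eq_exp]
      exact ⟨1, by rw [hv₁ hp]; simp; ring⟩
  let w : C(ℝ × ℝ, Circle) :=
    ⟨fun p ↦ if p ∈ M then Circle.exp (Real.pi * v p) else Circle.exp (-(Real.pi * v p)),
      Continuous.if (fun p hp ↦ key p (hM hp)) (by fun_prop) (by fun_prop)⟩
  have hw₁ : ∀ p ∈ M ∪ (C₀ ∪ C₁), w p = Circle.exp (Real.pi * v p) := by
    intro p hp
    by_cases hpM : p ∈ M
    · simp [w, hpM]
    · simpa [w, hpM] using (key p (hp.resolve_left hpM)).symm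
  have hw₂ : ∀ p ∉ M, w p = Circle.exp (-(Real.pi * v p)) := fun p hp ↦ by simp [w, hp]
  obtain ⟨θ, ⟨-, hθ⟩, -⟩ := Circle.isCoveringMap_exp.existsUnique_continuousMap_lifts w (0, 0) 0
    (by rw [hw₁ _ (Or.inr (Or.inl hc₀)), hv₀ hc₀]; simp)
  have hθ' : ∀ p, Circle.exp (θ p) = w p := fun p ↦ congrFun hθ p
  have hdisc : IsDiscrete (AddSubgroup.zmultiples (2 * Real.pi) : Set ℝ) :=
    isDiscrete_iff_discreteTopology.2
      (inferInstanceAs (DiscreteTopology (AddSubgroup.zmultiples (2 * Real.pi))))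
  have hmem : ∀ r s : ℝ, Circle.exp r = Circle.exp s →
      r - s ∈ (AddSubgroup.zmultiples (2 * Real.pi) : Set ℝ) := by
    intro r s h
    obtain ⟨m, hm⟩ := Circle.exp_eq_exp.1 h
    exact ⟨m, by simp [hm]⟩
  have const : ∀ (γ : ℝ → ℝ × ℝ) (u : C(ℝ × ℝ, ℝ)), Continuous γ →
      (∀ r ∈ Icc (0 : ℝ) 1, w (γ r) = Circle.exp (u (γ r))) →
      θ (γ 0) - u (γ 0) = θ (γ 1) - u (γ 1) := by
    intro γ u hγ h
    exact isPreconnected_Icc.constant_of_mapsTo (S := Icc (0 : ℝ) 1)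
      (f := fun r ↦ θ (γ r) - u (γ r)) hdisc
      (by fun_prop) (fun r hr ↦ hmem _ _ ((hθ' _).trans (h r hr))) (by simp) (by simp)
  -- Along the bottom the lift `θ` follows `π v` and gains `π` from corner to corner; along the
  -- other three sides it follows `-π v` and loses `π`.
  have e₁ := const (fun r ↦ (r, 0)) ⟨fun p ↦ Real.pi * v p, by fun_prop⟩ (by fun_prop)
    fun r hr ↦ hw₁ _ (hbot r hr)
  have e₂ := const (fun r ↦ (0, r)) ⟨fun p ↦ -(Real.pi * v p), by fun_prop⟩ (by fun_prop)
    fun r hr ↦ hw₂ _ (hleft r hr)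
  have e₃ := const (fun r ↦ (r, 1)) ⟨fun p ↦ -(Real.pi * v p), by fun_prop⟩ (by fun_prop)
    fun r hr ↦ hw₂ _ (htop r hr)
  have e₄ := const (fun r ↦ (1, r)) ⟨fun p ↦ -(Real.pi * v p), by fun_prop⟩ (by fun_prop)
    fun r hr ↦ hw₂ _ (hright r hr)
  have v0 := hv₀ hc₀
  have v1 := hv₁ hc₁
  simp only [ContinuousMap.coe_mk, v0, v1, Pi.zero_apply, Pi.one_apply] at e₁ e₂ e₃ e₄
  linarith [Real.pi_pos]

/-! ### The topology of the line of copies and arcs -/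

namespace AlternatingCone

variable {X : Type*} {x : X}

namespace Line

theorem copy_base_eq_arc_zero (n : ℕ) : copy x n x = arc x n 0 :=
  congrArg ofChain (Quot.sound (.start n))

theorem copy_succ_base_eq_arc_one (n : ℕ) : copy x (n + 1) x = arc x n 1 :=
  congrArg ofChain (Quot.sound (.finish n))

theorem eq_infty_or_copy_or_arc (y : Line x) :
    y = infty ∨ (∃ n a, y = copy x n a) ∨ ∃ n s, y = arc x n s := by
  obtain _ | ⟨⟨n, a⟩ | ⟨n, s⟩⟩ := y
  · exact .inl rfl
  · exact .inr (.inl ⟨_, _, rfl⟩)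
  · exact .inr (.inr ⟨_, _, rfl⟩)

theorem isOpen_iff [TopologicalSpace X] {U : Set (Line x)} : IsOpen U ↔
    (∀ n, IsOpen (copy x n ⁻¹' U)) ∧ (∀ n, IsOpen (arc x n ⁻¹' U)) ∧
      (infty ∈ U → ∃ m : ℕ, ∀ n ≥ m, (∀ a, copy x n a ∈ U) ∧ ∀ s, arc x n s ∈ U) := by
  have h : IsOpen U ↔ IsOpen (ofChain ⁻¹' U) ∧
    (infty ∈ U → ∃ m : ℕ, ∀ n ≥ m, (∀ a, copy x n a ∈ U) ∧ ∀ s, arc x n s ∈ U) := Iff.rfl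
  rw [h, ← and_assoc]
  refine and_congr_left' ?_
  rw [← isQuotientMap_quot_mk.isOpen_preimage, isOpen_sum_iff]
  refine and_congr ⟨fun h n ↦ h.preimage (by fun_prop : Continuous fun a ↦ (n, a)), fun h ↦ ?_⟩
    ⟨fun h n ↦ h.preimage (by fun_prop : Continuous fun a ↦ (n, a)), fun h ↦ ?_⟩
  all_goals
    rw [isOpen_prod_iff]
    exact fun n a ha ↦ ⟨{n}, _, isOpen_discrete _, h n, rfl, ha, by rintro ⟨k, b⟩ ⟨rfl, hb⟩; exact hb⟩

theorem continuous_copy [TopologicalSpace X] (n : ℕ) : Continuous (copy x n) :=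
  ⟨fun _ h ↦ (isOpen_iff.1 h).1 n⟩

theorem continuous_arc [TopologicalSpace X] (n : ℕ) : Continuous (arc x n) :=
  ⟨fun _ h ↦ (isOpen_iff.1 h).2.1 n⟩

/-- The function on the line with prescribed values at the new point, on the copies of `X` and on
the arcs. -/
def lift {Z : Type*} (z : Z) (f : ℕ → X → Z) (g : ℕ → I → Z) (h₀ : ∀ n, f n x = g n 0)
    (h₁ : ∀ n, f (n + 1) x = g n 1) : Line x → Z
  | infty => z
  | ofChain c => Quot.lift (Sum.elim (fun p ↦ f p.1 p.2) fun p ↦ g p.1 p.2)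
      (by rintro _ _ (n | n); exacts [h₀ n, h₁ n]) c

theorem continuous_of_eventually_eq [TopologicalSpace X] {Z : Type*} [TopologicalSpace Z]
    {F : Line x → Z}
    (hc : ∀ n, Continuous fun a ↦ F (copy x n a)) (ha : ∀ n, Continuous fun s ↦ F (arc x n s))
    (hF : ∃ m : ℕ, ∀ n ≥ m, (∀ a, F (copy x n a) = F infty) ∧ ∀ s, F (arc x n s) = F infty) :
    Continuous F := by
  refine ⟨fun U hU ↦ isOpen_iff.2 ⟨fun n ↦ hU.preimage (hc n), fun n ↦ hU.preimage (ha n), ?_⟩⟩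
  intro h
  obtain ⟨m, hm⟩ := hF
  refine ⟨m, fun n hn ↦ ⟨fun a ↦ ?_, fun s ↦ ?_⟩⟩
  · rwa [Set.mem_preimage, (hm n hn).1 a]
  · rwa [Set.mem_preimage, (hm n hn).2 s]

open Classical in
/-- The retraction of the line onto the `n`-th copy of `X`. -/
noncomputable def retr (x : X) (n : ℕ) : Line x → X :=
  lift x (fun m a ↦ if m = n then a else x) (fun _ _ ↦ x) (by simp) (by simp)

@[simp] theorem retr_copy_self (n : ℕ) (a : X) : retr x n (copy x n a) = a := if_pos rfl

theorem retr_copy_of_ne {n m : ℕ} (h : m ≠ n) (a : X) : retr x n (copy x m a) = x := if_neg h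

theorem continuous_retr [TopologicalSpace X] (n : ℕ) : Continuous (retr x n) := by
  refine continuous_of_eventually_eq (fun m ↦ ?_) (fun m ↦ continuous_const)
    ⟨n + 1, fun m hm ↦ ⟨fun a ↦ retr_copy_of_ne (by omega) a, fun s ↦ rfl⟩⟩
  obtain rfl | h := eq_or_ne m n
  · simpa using continuous_id'
  · simpa only [retr_copy_of_ne h] using continuous_const

/-- The map of the line to the unit interval that traverses the interval along the `n`-th arc and
is locally constant elsewhere. -/
noncomputable def stage (x : X) (n : ℕ) : Line x → I :=
  lift 1 (fun m _ ↦ if m ≤ n then 0 else 1) (fun m s ↦ if m < n then 0 else if m = n then s else 1)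
    (by intro m; obtain h | h | h := lt_trichotomy m n
        · simp [h, h.le]
        · simp [h]
        · simp [h.not_ge, h.not_gt, h.ne'])
    (by intro m; obtain h | h | h := lt_trichotomy m n
        · simp [h, Nat.succ_le_of_lt h]
        · simp [h]
        · simp [h.not_gt, h.ne'])

@[simp] theorem stage_infty (n : ℕ) : stage x n infty = 1 := rfl

theorem stage_copy (n m : ℕ) (a : X) : stage x n (copy x m a) = if m ≤ n then 0 else 1 := rfl

theorem stage_arc (n m : ℕ) (s : I) :
    stage x n (arc x m s) = if m < n then 0 else if m = n then s else 1 := rfl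

theorem continuous_stage [TopologicalSpace X] (n : ℕ) : Continuous (stage x n) := by
  refine continuous_of_eventually_eq (fun m ↦ ?_) (fun m ↦ ?_)
    ⟨n + 1, fun m hm ↦ ⟨fun a ↦ ?_, fun s ↦ ?_⟩⟩
  · simpa only [stage_copy] using continuous_const
  · simp only [stage_arc]
    split_ifs
    exacts [continuous_const, continuous_id, continuous_const]
  · simp [stage_copy, Nat.lt_of_succ_le hm]
  · simp [stage_arc, show ¬ m < n by omega, show m ≠ n by omega]

theorem copy_ne_infty (n : ℕ) (a : X) : copy x n a ≠ infty := nofun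

theorem arc_ne_infty (n : ℕ) (s : I) : arc x n s ≠ infty := nofun

theorem eq_of_copy_eq_copy {n m : ℕ} {a b : X} (h : copy x n a = copy x m b) : n = m := by
  have h₁ := congrArg (stage x n) h
  have h₂ := congrArg (stage x m) h
  simp only [stage_copy, le_refl, if_true] at h₁ h₂
  split_ifs at h₁ h₂ <;> first | omega | simp_all

theorem eq_infty_or_copy_or_arc_Ioo (y : Line x) :
    y = infty ∨ (∃ n a, y = copy x n a) ∨ ∃ n s, s ≠ 0 ∧ s ≠ 1 ∧ y = arc x n s := by
  obtain rfl | h | ⟨n, s, rfl⟩ := eq_infty_or_copy_or_arc y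
  · exact .inl rfl
  · exact .inr (.inl h)
  · by_cases h0 : s = 0
    · exact .inr (.inl ⟨n, x, by rw [h0, copy_base_eq_arc_zero]⟩)
    by_cases h1 : s = 1
    · exact .inr (.inl ⟨n + 1, x, by rw [h1, copy_succ_base_eq_arc_one]⟩)
    · exact .inr (.inr ⟨n, s, h0, h1, rfl⟩)

theorem stage_copy_ne_stage_arc (n m : ℕ) (a : X) {s : I} (h0 : s ≠ 0) (h1 : s ≠ 1) :
    stage x m (copy x n a) ≠ stage x m (arc x m s) := by
  intro h
  simp only [stage_copy, stage_arc, lt_irrefl, if_false, if_true] at h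
  split_ifs at h
  exacts [h0 h.symm, h1 h.symm]

theorem arc_ne_copy (n m : ℕ) (a : X) {s : I} (h0 : s ≠ 0) (h1 : s ≠ 1) :
    arc x m s ≠ copy x n a :=
  fun h ↦ stage_copy_ne_stage_arc n m a h0 h1 (congrArg (stage x m) h.symm)

theorem eq_infty_of_stage_eq_one {y : Line x} (h : ∀ n, stage x n y = 1) : y = infty := by
  obtain rfl | ⟨m, b, rfl⟩ | ⟨m, r, rfl⟩ := eq_infty_or_copy_or_arc y
  · rfl
  · simpa [stage_copy] using h m
  · simpa [stage_arc] using h (m + 1)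

/-- The maps to the unit interval separate points that are not in the same copy of `X`. -/
theorem eq_or_copy_of_stage_eq {y z : Line x} (h : ∀ n, stage x n y = stage x n z) :
    y = z ∨ ∃ n a b, y = copy x n a ∧ z = copy x n b := by
  obtain rfl | ⟨n, a, rfl⟩ | ⟨n, s, h0, h1, rfl⟩ := eq_infty_or_copy_or_arc_Ioo y
  · exact .inl (eq_infty_of_stage_eq_one fun n ↦ (h n).symm).symm
  · obtain rfl | ⟨m, b, rfl⟩ | ⟨m, r, h0', h1', rfl⟩ := eq_infty_or_copy_or_arc_Ioo z
    · exact .inl (eq_infty_of_stage_eq_one h)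
    · have h₁ := h n
      have h₂ := h m
      simp only [stage_copy, le_refl, if_true] at h₁ h₂
      obtain rfl : n = m := by split_ifs at h₁ h₂ <;> first | omega | simp_all
      exact .inr ⟨n, a, b, rfl, rfl⟩
    · exact absurd (h m) (stage_copy_ne_stage_arc n m a h0' h1')
  · obtain rfl | ⟨m, b, rfl⟩ | ⟨m, r, h0', h1', rfl⟩ := eq_infty_or_copy_or_arc_Ioo z
    · exact .inl (eq_infty_of_stage_eq_one h)
    · exact absurd (h n).symm (stage_copy_ne_stage_arc m n b h0 h1)
    · left
      have h₁ := h n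
      have h₂ := h m
      simp only [stage_arc, lt_irrefl, if_false, if_true] at h₁ h₂
      obtain hlt | rfl | hlt := lt_trichotomy n m
      · simp only [hlt.not_gt, hlt.ne', if_false] at h₁
        exact absurd h₁ h1
      · simp only [lt_irrefl, if_false, if_true] at h₁
        rw [h₁]
      · simp only [hlt.not_gt, hlt.ne', if_false] at h₂
        exact absurd h₂.symm h1'

/-- An ultrafilter containing one of the compact pieces `K n` converges there; any other avoids
every finite union of pieces and converges to `infty`. -/
instance [TopologicalSpace X] [CompactSpace X] : CompactSpace (Line x) := by
  refine ⟨isCompact_iff_ultrafilter_le_nhds.2 fun f _ ↦ ?_⟩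
  let K : ℕ → Set (Line x) := fun n ↦ Set.range (copy x n) ∪ Set.range (arc x n)
  have hK : ∀ n, IsCompact (K n) := fun n ↦
    (isCompact_range (continuous_copy n)).union (isCompact_range (continuous_arc n))
  by_cases h : ∃ n, K n ∈ f
  · obtain ⟨n, hn⟩ := h
    obtain ⟨y, -, hy⟩ := isCompact_iff_ultrafilter_le_nhds.1 (hK n) f (Filter.le_principal_iff.2 hn)
    exact ⟨y, trivial, hy⟩
  push Not at h
  refine ⟨infty, trivial, fun s hs ↦ ?_⟩
  obtain ⟨U, hUs, hU, hmem⟩ := mem_nhds_iff.1 hs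
  obtain ⟨m, hm⟩ := (isOpen_iff.1 hU).2.2 hmem
  have hf : (⋂ n ∈ Finset.range m, (K n)ᶜ) ∈ f :=
    (Filter.biInter_finset_mem _).2 fun n _ ↦ Ultrafilter.compl_mem_iff_notMem.2 (h n)
  refine Filter.mem_of_superset hf fun y hy ↦ hUs ?_
  simp only [Set.mem_iInter, Finset.mem_range] at hy
  obtain rfl | ⟨n, a, rfl⟩ | ⟨n, r, rfl⟩ := eq_infty_or_copy_or_arc y
  · exact hmem
  · exact (hm n (not_lt.1 fun hn ↦ hy n hn (.inl ⟨a, rfl⟩))).1 a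
  · exact (hm n (not_lt.1 fun hn ↦ hy n hn (.inr ⟨r, rfl⟩))).2 r

end Line

end AlternatingCone

/-! ### The quotient and its Hausdorff property -/

namespace AlternatingCone

open Line Topology

/-- The height at which the cylinder over the copy of `X` with index `n` is collapsed. -/
noncomputable def side (n : ℕ) : I := if Even n then 0 else 1

theorem exists_ge_side_eq {e : I} (he : e = 0 ∨ e = 1) (m : ℕ) : ∃ n ≥ m, side n = e := by
  obtain rfl | rfl := he
  · exact ⟨2 * m, by omega, by simp [side]⟩
  · exact ⟨2 * m + 1, by omega, by simp [side]⟩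

variable {X : Type*} {x : X}

theorem Collapse.exists_eq {p q : Line x × I} (h : Collapse x p q) :
    ∃ n a, p = (copy x n a, side n) ∧ q = (copy x n x, side n) := by
  obtain ⟨n, hn, a⟩ | ⟨n, hn, a⟩ := h
  · have : side n = 0 := if_pos (by grind)
    exact ⟨n, a, by rw [this], by rw [this]⟩
  · have : side n = 1 := if_neg (by grind)
    exact ⟨n, a, by rw [this], by rw [this]⟩

theorem collapse_side (n : ℕ) (a : X) :
    Collapse x (copy x n a, side n) (copy x n x, side n) := by
  unfold side
  split_ifs with h
  · exact .bottom n (by grind) a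
  · exact .top n (by grind) a

variable [TopologicalSpace X]

namespace AC

/-- The quotient map from the product of the line with the unit interval. -/
def mk (p : Line x × I) : AC X x := Quot.mk _ p

theorem isQuotientMap_mk : IsQuotientMap (mk (x := x)) := isQuotientMap_quot_mk

theorem continuous_mk : Continuous (mk (x := x)) := continuous_quot_mk

theorem surjective_mk : Function.Surjective (mk (x := x)) := Quot.mk_surjective

theorem mk_copy_side (n : ℕ) (a b : X) : mk (copy x n a, side n) = mk (copy x n b, side n) :=
  (Quot.sound (collapse_side n a)).trans (Quot.sound (collapse_side n b)).symm

/-- A function on the product of the line with the unit interval that takes the same values on the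
collapsed slices descends to the alternating cone. -/
def lift {Z : Type*} (f : Line x × I → Z)
    (hf : ∀ n a, f (copy x n a, side n) = f (copy x n x, side n)) : AC X x → Z :=
  Quot.lift f fun p q h ↦ by obtain ⟨n, a, rfl, rfl⟩ := h.exists_eq; exact hf n a

@[simp] theorem lift_mk {Z : Type*} (f : Line x × I → Z)
    (hf : ∀ n a, f (copy x n a, side n) = f (copy x n x, side n)) (p : Line x × I) :
    lift f hf (mk p) = f p := rfl

theorem continuous_lift {Z : Type*} [TopologicalSpace Z] {f : Line x × I → Z} (h : Continuous f)
    (hf : ∀ n a, f (copy x n a, side n) = f (copy x n x, side n)) : Continuous (lift f hf) :=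
  isQuotientMap_mk.continuous_iff.2 h

/-- Continuous real functions separate points: the height, the stages, and Urysohn functions on a
single copy. -/
instance [CompactSpace X] [T2Space X] : T2Space (AC X x) := by
  refine ⟨fun p q hpq ↦ ?_⟩
  suffices h : ∃ f : AC X x → ℝ, Continuous f ∧ f p ≠ f q by
    obtain ⟨f, hf, hne⟩ := h
    exact separated_by_continuous hf hne
  obtain ⟨⟨y, s⟩, rfl⟩ := surjective_mk p
  obtain ⟨⟨z, t⟩, rfl⟩ := surjective_mk q
  by_contra! H
  obtain rfl : s = t := Subtype.ext <| H (lift (fun p ↦ (p.2 : ℝ)) fun _ _ ↦ rfl)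
    (continuous_lift (by fun_prop) _)
  obtain rfl | ⟨n, a, b, rfl, rfl⟩ := eq_or_copy_of_stage_eq (y := y) (z := z) fun n ↦
    Subtype.ext <| H (lift (fun p ↦ (stage x n p.1 : ℝ)) fun m a ↦ by simp [stage_copy])
      (continuous_lift (by have := continuous_stage (x := x) n; fun_prop) _)
  · exact hpq rfl
  have hs : (s : ℝ) - side n ≠ 0 := by
    intro h
    obtain rfl : s = side n := Subtype.ext (sub_eq_zero.1 h)
    exact hpq (mk_copy_side n a b)
  have hab : a ≠ b := by rintro rfl; exact hpq rfl
  obtain ⟨f, hfa, hfb, -⟩ := exists_continuous_zero_one_of_isClosed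
    (isClosed_singleton (x := a)) (isClosed_singleton (x := b)) (by simpa using hab)
  -- The factor vanishing at height `side n` makes the Urysohn function on copy `n` descend to the
  -- quotient.
  have := H (lift (fun p ↦ ((p.2 : ℝ) - side n) * f (retr x n p.1)) fun m a ↦ by
      obtain rfl | h := eq_or_ne m n
      · simp
      · simp [retr_copy_of_ne h]) (continuous_lift (by
        have := continuous_retr (x := x) n; fun_prop) _)
  simp only [lift_mk, retr_copy_self, hfa rfl, hfb rfl, Pi.zero_apply, Pi.one_apply, mul_zero,
    mul_one] at this
  exact hs this.symm

/-! ### Tails and projections near the new point -/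

theorem mk_infty_eq_iff {y : Line x} {s e : I} : mk (y, s) = mk (infty, e) ↔ y = infty ∧ s = e := by
  refine ⟨fun h ↦ ⟨eq_infty_of_stage_eq_one fun n ↦ ?_, ?_⟩, by rintro ⟨rfl, rfl⟩; rfl⟩
  · exact congrArg (lift (fun p ↦ stage x n p.1) fun m a ↦ by simp [stage_copy]) h
  · exact congrArg (lift (fun p ↦ p.2) fun m a ↦ rfl) h

/-- The set of the points at height `e` that lie over the new point of the line or over a copy of
`X` that is collapsed at height `e` and has index at least `m`. -/
def tail (x : X) (e : I) (m : ℕ) : Set (AC X x) :=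
  {q | lift (fun p : Line x × I ↦
    (p.1 = infty ∨ ∃ n ≥ m, side n = e ∧ ∃ a, p.1 = copy x n a) ∧ p.2 = e) (by
      intro n a
      simp only [copy_ne_infty, false_or, eq_iff_iff]
      refine and_congr_left fun _ ↦ ⟨?_, ?_⟩ <;>
      · rintro ⟨k, hk, he, b, hb⟩
        obtain rfl := eq_of_copy_eq_copy hb
        exact ⟨n, hk, he, _, rfl⟩) q}

theorem mk_mem_tail {e : I} {m : ℕ} {y : Line x} {s : I} : mk (y, s) ∈ tail x e m ↔
    (y = infty ∨ ∃ n ≥ m, side n = e ∧ ∃ a, y = copy x n a) ∧ s = e := Iff.rfl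

/-- The trace on each copy is everything or nothing, an arc meets the tail in endpoints at most, and
the condition at `infty` is vacuous for the complement. -/
theorem isClosed_tail (e : I) (m : ℕ) : IsClosed (tail x e m) := by
  rw [← isQuotientMap_mk.isClosed_preimage]
  have : IsClosed {y : Line x | y = infty ∨ ∃ n ≥ m, side n = e ∧ ∃ a, y = copy x n a} := by
    rw [← isOpen_compl_iff, Line.isOpen_iff]
    refine ⟨fun n ↦ ?_, fun n ↦ ?_, fun h ↦ absurd (.inl rfl) h⟩
    · suffices h : copy x n ⁻¹' {y : Line x | y = infty ∨ ∃ n ≥ m, side n = e ∧ ∃ a, y = copy x n a}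
          = {_a | n ≥ m ∧ side n = e} by
        rw [Set.preimage_compl, h, Set.compl_ofPred]
        exact isOpen_const
      ext a
      simp only [Set.mem_preimage, Set.mem_ofPred_eq, copy_ne_infty, false_or]
      constructor
      · rintro ⟨k, hk, he, b, hb⟩
        obtain rfl := eq_of_copy_eq_copy hb
        exact ⟨hk, he⟩
      · rintro ⟨hk, he⟩
        exact ⟨n, hk, he, a, rfl⟩
    · rw [Set.preimage_compl, isOpen_compl_iff]
      refine ((Set.toFinite {(0 : I), 1}).subset fun s hs ↦ ?_).isClosed
      by_contra h
      simp only [Set.mem_insert_iff, Set.mem_singleton_iff, not_or] at h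
      obtain h' | ⟨k, -, -, a, h'⟩ := hs
      · exact arc_ne_infty _ _ h'
      · exact arc_ne_copy _ _ _ h.1 h.2 h'
  exact this.prod (isClosed_singleton (x := e))

/-- The height and the stages cut the point out, so `X` need not be Hausdorff. -/
theorem isClosed_singleton_mk_infty (e : I) : IsClosed {mk (infty (x := x), e)} := by
  rw [← isQuotientMap_mk.isClosed_preimage]
  convert (isClosed_singleton (x := e)).preimage (f := (Prod.snd : Line x × I → I)) (by fun_prop)
    |>.inter ((isClosed_iInter fun n ↦ (isClosed_singleton (x := (1 : I))).preimage
      (continuous_stage (x := x) n)).preimage (f := (Prod.fst : Line x × I → Line x))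
      (by fun_prop)) using 1
  ext ⟨y, s⟩
  simp only [Set.mem_preimage, Set.mem_singleton_iff, mk_infty_eq_iff, Set.mem_inter_iff,
    Set.mem_iInter]
  exact ⟨fun h ↦ ⟨h.2, by rw [h.1]; exact fun _ ↦ rfl⟩,
    fun h ↦ ⟨eq_infty_of_stage_eq_one h.2, h.1⟩⟩

theorem exists_notMem_tail {e : I} {q : AC X x} (hq : q ≠ mk (infty, e)) :
    ∃ m, q ∉ tail x e m := by
  obtain ⟨⟨y, s⟩, rfl⟩ := surjective_mk q
  simp only [mk_mem_tail]
  obtain rfl | ⟨n, a, rfl⟩ | ⟨n, r, h0, h1, rfl⟩ := eq_infty_or_copy_or_arc_Ioo y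
  · exact ⟨0, fun h ↦ hq (by rw [h.2])⟩
  · refine ⟨n + 1, ?_⟩
    rintro ⟨h | ⟨k, hk, -, b, hb⟩, -⟩
    · exact copy_ne_infty _ _ h
    · obtain rfl := eq_of_copy_eq_copy hb
      omega
  · refine ⟨0, ?_⟩
    rintro ⟨h | ⟨k, hk, -, b, hb⟩, -⟩
    · exact arc_ne_infty _ _ h
    · exact arc_ne_copy _ _ _ h0 h1 hb

open Classical in
/-- The projection of the alternating cone to the copy of `X` with index `n`, which is collapsed at
height `side n`. It is continuous away from the apex of the cone over that copy. -/
noncomputable def proj (x : X) (n : ℕ) : AC X x → X :=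
  lift (fun p ↦ if p.2 = side n then x else retr x n p.1) (by
    intro m a
    obtain rfl | h := eq_or_ne m n
    · simp
    · simp [retr_copy_of_ne h])

theorem proj_mk {n : ℕ} {s : I} (h : s ≠ side n) (y : Line x) :
    proj x n (mk (y, s)) = retr x n y := if_neg h

/-- Off the tail, which contains the apex over copy `n`, the projection is induced by `retr x n`: at
height `side n` the remaining points of the line all retract to `x`. -/
theorem continuousOn_proj {n m : ℕ} (h : m ≤ n) : ContinuousOn (proj x n) (tail x (side n) m)ᶜ := by
  rw [isQuotientMap_mk.continuousOn_isOpen_iff (isClosed_tail _ _).isOpen_compl]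
  refine ((continuous_retr n).comp continuous_fst).continuousOn.congr ?_
  rintro ⟨y, s⟩ hy
  by_cases hs : s = side n
  · have : proj x n (mk (y, s)) = x := if_pos hs
    simp only [Function.comp_apply, this]
    obtain rfl | ⟨k, a, rfl⟩ | ⟨k, r, rfl⟩ := eq_infty_or_copy_or_arc y
    · rfl
    · rw [retr_copy_of_ne]
      rintro rfl
      exact hy ⟨.inr ⟨k, h, rfl, a, rfl⟩, hs⟩
    · rfl
  · exact proj_mk hs y

/-! ### Local constancy of essentiality -/

variable {P : Type*}

/-- The map from `X` to itself that embeds `X` as the copy with index `n`, moves it by a map to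
the alternating cone and projects it back, is continuous and null-homotopic. -/
def NullAt (G : Line x × P → AC X x) (n : ℕ) (p : P) : Prop :=
  ∃ f : C(X, X), (∀ a, f a = proj x n (G (copy x n a, p))) ∧ f.Nullhomotopic

/-- A path in `V` yields a homotopy of self-maps of `X`, because the projection is continuous along
it. -/
theorem NullAt.of_joinedIn [TopologicalSpace P] {G : Line x × P → AC X x} (hG : Continuous G)
    {V : Set P} {m n : ℕ}
    (hn : m ≤ n) (hV : ∀ q ∈ V, ∀ a, G (copy x n a, q) ∉ tail x (side n) m) {p q : P}
    (hpq : JoinedIn V p q) (h : NullAt G n p) : NullAt G n q := by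
  obtain ⟨γ, hγ⟩ := hpq
  obtain ⟨f, hf, hnull⟩ := h
  have := continuous_copy (x := x) n
  have hc : Continuous fun z : I × X ↦ proj x n (G (copy x n z.2, γ z.1)) :=
    (continuousOn_proj hn).comp_continuous (by fun_prop) fun z ↦ hV _ (hγ z.1) z.2
  let g : C(X, X) := ⟨fun a ↦ proj x n (G (copy x n a, γ 1)), hc.comp (by fun_prop :
    Continuous fun a : X ↦ ((1 : I), a))⟩
  have hfg : f.Homotopic g := ⟨⟨⟨_, hc⟩, fun a ↦ by simp [hf], fun a ↦ rfl⟩⟩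
  obtain ⟨c, hc⟩ := hnull
  exact ⟨g, fun a ↦ by simp [g], c, hfg.symm.trans hc⟩

/-- Some closed tail misses `G (infty, p)`, hence misses the image of a product neighborhood of
`(infty, p)`; its first factor contains all late copies, and its second may be shrunk to a
path-connected one. -/
theorem eventually_nullAt_iff [TopologicalSpace P] [LocallyPathConnectedSpace P]
    {G : Line x × P → AC X x}
    (hG : Continuous G) {e : I} {p : P} (hp : G (infty, p) ≠ mk (infty, e)) :
    ∀ᶠ q in 𝓝 p, G (infty, q) ≠ mk (infty, e) ∧
      ∃ m, ∀ n ≥ m, side n = e → (NullAt G n q ↔ NullAt G n p) := by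
  obtain ⟨m, hm⟩ := exists_notMem_tail hp
  obtain ⟨U, hU, W, hW, hUW⟩ := mem_nhds_prod_iff.1
    (hG.continuousAt.preimage_mem_nhds ((isClosed_tail e m).isOpen_compl.mem_nhds hm))
  obtain ⟨V, ⟨hV, hVc⟩, hVW⟩ := (LocallyPathConnectedSpace.path_connected_basis p).mem_iff.1 hW
  obtain ⟨U', hU', hUo, hmem⟩ := mem_nhds_iff.1 hU
  obtain ⟨k, hk⟩ := (Line.isOpen_iff.1 hUo).2.2 hmem
  filter_upwards [hV] with q hq
  refine ⟨fun h ↦ hUW (⟨mem_of_mem_nhds hU, hVW hq⟩ : (infty, q) ∈ U ×ˢ W) ?_, max m k, ?_⟩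
  · rw [h]
    exact ⟨.inl rfl, rfl⟩
  rintro n hn rfl
  have hVn : ∀ q ∈ V, ∀ a, G (copy x n a, q) ∉ tail x (side n) m := fun q hq a ↦
    hUW (⟨hU' ((hk n (le_trans (le_max_right _ _) hn)).1 a), hVW hq⟩ : (copy x n a, q) ∈ U ×ˢ W)
  have hmn := le_trans (le_max_left _ _) hn
  have hj := hVc.joinedIn p (mem_of_mem_nhds hV) q hq
  exact ⟨.of_joinedIn hG hmn hVn hj.symm, .of_joinedIn hG hmn hVn hj⟩

/-- The parameters for which the new point at height `e` is avoided and arbitrarily late copies of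
`X` that are collapsed at height `e` are mapped essentially. -/
def essential (G : Line x × P → AC X x) (e : I) : Set P :=
  {p | G (infty, p) ≠ mk (infty, e) ∧ ∀ m, ∃ n ≥ m, side n = e ∧ ¬ NullAt G n p}

theorem eventually_mem_essential_iff [TopologicalSpace P] [LocallyPathConnectedSpace P]
    {G : Line x × P → AC X x}
    (hG : Continuous G) {e : I} {p : P} (hp : G (infty, p) ≠ mk (infty, e)) :
    ∀ᶠ q in 𝓝 p, (q ∈ essential G e ↔ p ∈ essential G e) := by
  filter_upwards [eventually_nullAt_iff hG hp] with q ⟨hq, k, hk⟩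
  refine and_congr (iff_of_true hq hp) ⟨fun h m ↦ ?_, fun h m ↦ ?_⟩
  all_goals
    obtain ⟨n, hn, he, hN⟩ := h (max m k)
    have := hk n (le_trans (le_max_right _ _) hn) he
    exact ⟨n, le_trans (le_max_left _ _) hn, he, by tauto⟩

theorem isOpen_essential [TopologicalSpace P] [LocallyPathConnectedSpace P]
    {G : Line x × P → AC X x}
    (hG : Continuous G) (e : I) : IsOpen (essential G e) :=
  isOpen_iff_mem_nhds.2 fun _ hp ↦ (eventually_mem_essential_iff hG hp.1).mono fun _ h ↦ h.2 hp

theorem mem_essential_of_mem_closure [TopologicalSpace P] [LocallyPathConnectedSpace P]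
    {G : Line x × P → AC X x}
    (hG : Continuous G) {e : I} {p : P} (hp : G (infty, p) ≠ mk (infty, e))
    (h : p ∈ closure (essential G e)) : p ∈ essential G e := by
  obtain ⟨q, hq, hq'⟩ :=
    ((mem_closure_iff_frequently.1 h).and_eventually (eventually_mem_essential_iff hG hp)).exists
  exact hq'.1 hq

theorem notMem_essential_of_forall_eq {G : Line x × P → AC X x} {e : I} {p : P}
    (h : ∀ n a, side n = e → G (copy x n a, p) = G (copy x n x, p)) : p ∉ essential G e := by
  rintro ⟨-, h'⟩
  obtain ⟨n, -, rfl, hN⟩ := h' 0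
  exact hN ⟨.const X (proj x n (G (copy x n x, p))), fun a ↦ by rw [h n a rfl]; rfl,
    ContinuousMap.nullhomotopic_of_constant _⟩

theorem mem_essential_of_eq_mk (hX : ¬ ContractibleSpace X) {G : Line x × P → AC X x} {e s : I}
    (he : e = 0 ∨ e = 1) (hs : s ≠ e) {p : P} (h : ∀ y, G (y, p) = mk (y, s)) :
    p ∈ essential G e := by
  refine ⟨fun h' ↦ hs (mk_infty_eq_iff.1 ((h _).symm.trans h')).2, fun m ↦ ?_⟩
  obtain ⟨n, hn, rfl⟩ := exists_ge_side_eq he m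
  refine ⟨n, hn, rfl, ?_⟩
  rintro ⟨f, hf, hnull⟩
  obtain rfl : f = .id X := by
    ext a
    rw [hf, h, proj_mk hs, retr_copy_self, ContinuousMap.id_apply]
  exact hX ((contractible_iff_id_nullhomotopic X).2 hnull)

theorem not_contractibleSpace (hX : ¬ ContractibleSpace X) : ¬ ContractibleSpace (AC X x) := by
  intro hC
  obtain ⟨c, ⟨H⟩⟩ := id_nullhomotopic (AC X x)
  -- Clamping both parameters to the interval extends the family over the whole plane, as the
  -- separation lemma requires.
  let r : ℝ → I := Set.projIcc 0 1 zero_le_one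
  have hr : Continuous r := continuous_projIcc
  have r0 : r 0 = 0 := Set.projIcc_left _
  have r1 : r 1 = 1 := Set.projIcc_right _
  let G : Line x × (ℝ × ℝ) → AC X x := fun z ↦ H (r z.2.2, mk (z.1, r z.2.1))
  have hG : Continuous G := by
    have := continuous_mk (x := x)
    fun_prop
  have hbot : ∀ h y, G (y, (h, 0)) = mk (y, r h) := fun h y ↦ by simp [G, r0]
  have htop : ∀ h e, (h, (1 : ℝ)) ∉ essential G e := fun h e ↦
    notMem_essential_of_forall_eq fun n a _ ↦ by simp [G, r1]
  have hside : ∀ h t, (h, t) ∉ essential G (r h) := fun h t ↦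
    notMem_essential_of_forall_eq fun n a hn ↦ by
      simp only [G, ← hn, mk_copy_side n a x]
  let C : I → Set (ℝ × ℝ) := fun e ↦ {p | G (infty, p) = mk (infty, e)}
  have hCclosed : ∀ e, IsClosed (C e) := fun e ↦
    (isClosed_singleton_mk_infty e).preimage (by fun_prop : Continuous fun p ↦ G (infty, p))
  refine not_separates_bottom_of_frontier_subset_union (M := essential G 0 ∩ essential G 1)
    (hCclosed 0) (hCclosed 1) ?_ ?_ ?_ ?_ ?_ ?_ ?_ ?_
  · rw [Set.disjoint_left]
    intro p h h'
    exact zero_ne_one (mk_infty_eq_iff.1 ((h : _ = _).symm.trans h')).2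
  · rw [((isOpen_essential hG 0).inter (isOpen_essential hG 1)).frontier_eq]
    rintro p ⟨hp, hpM⟩
    by_contra hpC
    simp only [Set.mem_union, not_or] at hpC
    exact hpM ⟨mem_essential_of_mem_closure hG hpC.1 (closure_mono Set.inter_subset_left hp),
      mem_essential_of_mem_closure hG hpC.2 (closure_mono Set.inter_subset_right hp)⟩
  · simp [C, hbot, r0]
  · simp [C, hbot, r1]
  · intro h _
    by_cases h0 : r h = 0
    · exact .inr (.inl (by simp [C, hbot, h0]))
    by_cases h1 : r h = 1
    · exact .inr (.inr (by simp [C, hbot, h1]))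
    exact .inl ⟨mem_essential_of_eq_mk hX (.inl rfl) h0 (hbot h),
      mem_essential_of_eq_mk hX (.inr rfl) h1 (hbot h)⟩
  · exact fun t _ h ↦ hside 0 t (by rw [r0]; exact h.1)
  · exact fun t _ h ↦ hside 1 t (by rw [r1]; exact h.2)
  · exact fun h _ h' ↦ htop h 0 h'.1

end AC

end AlternatingCone

theorem theorem2 {X : Type*} [TopologicalSpace X] [CompactSpace X]
    (hX : ¬ ContractibleSpace X) (x : X) :
    CompactSpace (AlternatingCone.AC X x) ∧
      ¬ ContractibleSpace (AlternatingCone.AC X x) ∧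
      (T2Space X → T2Space (AlternatingCone.AC X x)) :=
  ⟨inferInstance, AlternatingCone.AC.not_contractibleSpace hX, fun _ ↦ inferInstance⟩
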